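/- Let $P$ be a partially ordered set. If $P$ is well-quasi-ordered (that is, well-founded and without infinite antichains) and the set $\mathcal{J}^{\neg\downarrow}(P)$ of non-principal ideals of $P$, ordered by inclusion, is better-quasi-ordered, then $P$ is better-quasi-ordered. Here an *ideal* of $P$ is a non-empty, downward closed, up-directed subset of $P$; it is *non-principal* if it is not of the form $\{y\in P : y\le x\}$ with $x\in P$. Identify each finite subset of $\mathbb{N}$ with the increasing list of its elements. A *barrier* is an infinite set $B$ of finite subsets of $\mathbb{N}$ such that every infinite $X\subseteq\bigcup B$ has a non-empty initial segment belonging to $B$, and no member of $B$ is properly contained in another one; its *order type* is its order type under the lexicographic order, by which every barrier is well-ordered. For finite $s,t\subseteq\mathbb{N}$ write $s\vartriangleleft t$ if there is a finite $r\subseteq\mathbb{N}$ such that $s$ is a proper initial segment of $r$ and $t$ is obtained from $r$ by deleting its least element. A poset $Q$ is *better-quasi-ordered* if, for every countable ordinal $\alpha$, every barrier $B$ of order type at most $\alpha$ and every map $f:B\to Q$, there are $s,t\in B$ with $s\vartriangleleft t$ and $f(s)\le f(t)$. -/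

import Mathlib

namespace BQO

/-- `s ≤_in X`: the finite set `s`, listed increasingly, is an initial segment of `X ⊆ ℕ`,
listed increasingly (`X` finite or infinite). -/
def IsInit (s : Finset ℕ) (X : Set ℕ) : Prop :=
  (↑s : Set ℕ) ⊆ X ∧ ∀ x ∈ X, ∀ y ∈ s, x ≤ y → x ∈ s

/-- `*s`: the set `s` with its least element deleted (`*∅ = ∅`). -/
def tail (s : Finset ℕ) : Finset ℕ :=
  s.filter fun n => ∃ m ∈ s, m < n

/-- `s ◁ t`: there is a finite `r` of which `s` is a proper initial segment with `t = *r`. -/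
def Shift (s t : Finset ℕ) : Prop :=
  ∃ r : Finset ℕ, IsInit s ↑r ∧ s ≠ r ∧ t = tail r

/-- The strict lexicographic order on finite sets of natural numbers, each one identified with
the increasing list of its elements. -/
def LexLT (s t : Finset ℕ) : Prop :=
  s.sort (· ≤ ·) < t.sort (· ≤ ·)

/-- The union `⋃ B` of a set `B` of finite sets of natural numbers. -/
def base (B : Set (Finset ℕ)) : Set ℕ :=
  {n | ∃ s ∈ B, n ∈ s}

/-- A block: an infinite set `B` of finite subsets of `ℕ` such that every infinite `X ⊆ ⋃ B` has a
non-empty initial segment in `B`. -/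
structure IsBlock (B : Set (Finset ℕ)) : Prop where
  infinite : B.Infinite
  exists_init : ∀ X : Set ℕ, X ⊆ base B → X.Infinite → ∃ s ∈ B, s ≠ ∅ ∧ IsInit s X

/-- A barrier: a block which is an antichain for inclusion. -/
structure IsBarrier (B : Set (Finset ℕ)) : Prop extends IsBlock B where
  antichain : IsAntichain (· ⊆ ·) B

/-- `B` is well-ordered by the lexicographic order, with order type at most `α`. -/
def LexTypeLE (B : Set (Finset ℕ)) (α : Ordinal.{0}) : Prop :=
  ∃ _ : IsWellOrder ↥B (fun s t => LexLT s.1 t.1),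
    Ordinal.type (fun s t : ↥B => LexLT s.1 t.1) ≤ α

/-- A map from a set of finite subsets of `ℕ` (in practice a barrier) into an order is good if
`f s ≤ f t` for some `s ◁ t`. -/
def IsGood {P : Type*} [LE P] {B : Set (Finset ℕ)} (f : ↥B → P) : Prop :=
  ∃ s t : ↥B, Shift s.1 t.1 ∧ f s ≤ f t

/-- `P` is `α`-better-quasi-ordered. -/
def IsAlphaBQO (α : Ordinal.{0}) (P : Type*) [LE P] : Prop :=
  ∀ B : Set (Finset ℕ), IsBarrier B → LexTypeLE B α → ∀ f : ↥B → P, IsGood f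

/-- `P` is better-quasi-ordered: it is `α`-better-quasi-ordered for every countable ordinal `α`. -/
def IsBQO (P : Type*) [LE P] : Prop :=
  ∀ α : Ordinal.{0}, α.card ≤ Cardinal.aleph0 → IsAlphaBQO α P

/-- The non-principal ideals of `P`, ordered by inclusion. -/
abbrev NonPrincipalIdeal (P : Type*) [PartialOrder P] : Type _ :=
  {I : Order.Ideal P // ∀ x : P, I ≠ Order.Ideal.principal x}

end BQO

/-!
A map `f` on a barrier that is not good extends to a map `φ` on infinite sets that is locally
constant and bad: `φ X ≤ φ (*X)` never holds, where `*X` is `X` without its least element. If `φ`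
is constant on the sets `u ∪ {n} ∪ ⋯` for each `n`, then, `P` being well-quasi-ordered, these
constants can be thinned out to a sequence that is constant or cofinal in a non-principal ideal.
Bar induction therefore gives an infinite `Y` on which `φ` is constant, which badness excludes, or
tends to a non-principal ideal along a bar. That bar contains a barrier, and as the non-principal
ideals are better-quasi-ordered, there are `s ◁ t` on it with limits `I s ⊆ I t`. Once the element
after `s` is fixed, `φ` is bounded by some `q` in `I s`; since `q ∈ I t`, choosing the element
after `t` large enough gives an `X` with `φ X ≤ q ≤ φ (*X)`.
-/

namespace BQO

open Filter
open scoped Function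

/-! ### Initial segments and basic neighbourhoods -/

/-- The strict upper bounds of `u`, that is, the numbers by which the increasing list `u` can be
continued. -/
def above (u : Finset ℕ) : Set ℕ := {n | ∀ x ∈ u, x < n}

/-- The Ellentuck neighbourhood `[u, Y]`: the infinite sets whose increasing enumeration begins
with `u` and continues with elements of `Y`, which thus lie in `above u`. -/
def cone (u : Finset ℕ) (Y : Set ℕ) : Set (Set ℕ) :=
  {X | X.Infinite ∧ IsInit u X ∧ X ⊆ ↑u ∪ Y}

/-- `F` is a bar of the neighbourhood `[u, Y]`: each of its members has an initial segment in `F`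
that extends `u`. -/
def Bars (F : Set (Finset ℕ)) (u : Finset ℕ) (Y : Set ℕ) : Prop :=
  ∀ X ∈ cone u Y, ∃ v ∈ F, u ⊆ v ∧ IsInit v X

lemma above_anti {u v : Finset ℕ} (h : u ⊆ v) : above v ⊆ above u :=
  fun _ hx y hy => hx y (h hy)

lemma eventually_mem_above (u : Finset ℕ) : ∀ᶠ n in atTop, n ∈ above u :=
  (Finset.eventually_all u).2 fun x _ => eventually_gt_atTop x

lemma infinite_inter_above {Y : Set ℕ} (hY : Y.Infinite) (u : Finset ℕ) :
    (Y ∩ above u).Infinite :=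
  Nat.frequently_atTop_iff_infinite.1
    ((Nat.frequently_atTop_iff_infinite.2 hY).and_eventually (eventually_mem_above u))

lemma isInit_empty (X : Set ℕ) : IsInit ∅ X := by simp [IsInit]

lemma isInit_union {u : Finset ℕ} {Z : Set ℕ} (hZ : Z ⊆ above u) : IsInit u (↑u ∪ Z) := by
  refine ⟨Set.subset_union_left, fun x hx y hy hxy => ?_⟩
  rcases hx with hx | hx
  · exact hx
  · exact absurd (hZ hx y hy) hxy.not_gt

lemma isInit_insert {u : Finset ℕ} {n : ℕ} (hn : n ∈ above u) : IsInit u ↑(insert n u) := by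
  rw [Finset.coe_insert, Set.insert_eq, Set.union_comm]
  exact isInit_union (Set.singleton_subset_iff.2 hn)

section IsInit

variable {s t : Finset ℕ} {X : Set ℕ}

lemma IsInit.trans (hs : IsInit s ↑t) (ht : IsInit t X) : IsInit s X :=
  ⟨hs.1.trans ht.1, fun x hx y hy h => hs.2 x (ht.2 x hx y (hs.1 hy) h) y hy h⟩

lemma IsInit.isInit_of_subset (hs : IsInit s X) (ht : IsInit t X) (h : s ⊆ t) : IsInit s ↑t :=
  ⟨Finset.coe_subset.2 h, fun x hx y hy hxy => hs.2 x (ht.1 hx) y hy hxy⟩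

lemma IsInit.subset_total (hs : IsInit s X) (ht : IsInit t X) : s ⊆ t ∨ t ⊆ s := by
  by_contra! h
  obtain ⟨⟨x, hx, hxt⟩, y, hy, hys⟩ := h.imp Finset.not_subset.1 Finset.not_subset.1
  rcases le_total x y with hxy | hxy
  · exact hxt (ht.2 x (hs.1 hx) y hy hxy)
  · exact hys (hs.2 y (ht.1 hy) x hx hxy)

lemma IsInit.mem_above (hs : IsInit s X) {x : ℕ} (hx : x ∈ X) (hxs : x ∉ s) : x ∈ above s := by
  intro y hy
  by_contra! hxy
  exact hxs (hs.2 x hx y hy hxy)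

lemma IsInit.exists_insert (hs : IsInit s X) (hne : (X \ s).Nonempty) :
    ∃ n ∈ X ∩ above s, IsInit (insert n s) X := by
  obtain ⟨n, ⟨hnX, hns⟩, hmin⟩ := WellFounded.has_min wellFounded_lt (X \ s) hne
  have hn : n ∈ above s := hs.mem_above hnX hns
  refine ⟨n, ⟨hnX, hn⟩, ?_, fun x hx y hy hxy => ?_⟩
  · rw [Finset.coe_insert]
    exact Set.insert_subset hnX hs.1
  · by_contra hxs
    rw [Finset.mem_insert, not_or] at hxs
    have hnx : n ≤ x := not_lt.1 (hmin x ⟨hx, hxs.2⟩)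
    rcases Finset.mem_insert.1 hy with rfl | hy
    · exact hxs.1 (hxy.antisymm hnx)
    · exact absurd (hn y hy) (hnx.trans hxy).not_gt

lemma exists_isInit_mem {x : ℕ} (hx : x ∈ X) : ∃ s, IsInit s X ∧ x ∈ s := by
  have hfin : (X ∩ Set.Iic x).Finite := (Set.finite_Iic x).inter_of_right X
  refine ⟨hfin.toFinset, ⟨by simp, fun z hz y hy hzy => ?_⟩, by simpa using hx⟩
  rw [Set.Finite.mem_toFinset] at hy ⊢
  exact ⟨hz, hzy.trans hy.2⟩

end IsInit

section Cone

variable {u : Finset ℕ} {X Y Y' : Set ℕ}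

lemma mem_cone_empty : X ∈ cone ∅ Y ↔ X.Infinite ∧ X ⊆ Y := by
  simp [cone, isInit_empty]

lemma cone_mono (h : Y' ∩ above u ⊆ Y) : cone u Y' ⊆ cone u Y := by
  rintro X ⟨hX, hu, hXY⟩
  refine ⟨hX, hu, fun x hx => or_iff_not_imp_left.2 fun hxu => ?_⟩
  exact h ⟨(hXY hx).resolve_left hxu, hu.mem_above hx hxu⟩

lemma union_above_mem_cone (hY : Y.Infinite) (u : Finset ℕ) : ↑u ∪ Y ∩ above u ∈ cone u Y :=
  ⟨(infinite_inter_above hY u).mono Set.subset_union_right, isInit_union Set.inter_subset_right,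
    Set.union_subset_union_right _ Set.inter_subset_left⟩

lemma cone_subset_cone {v : Finset ℕ} (hu : IsInit u ↑v) (hv : ↑v ⊆ ↑u ∪ Y) :
    cone v Y ⊆ cone u Y :=
  fun _ ⟨hX, hvX, hXY⟩ =>
    ⟨hX, hu.trans hvX, hXY.trans (Set.union_subset hv Set.subset_union_right)⟩

lemma exists_mem_cone_insert (hX : X ∈ cone u Y) : ∃ n ∈ Y ∩ above u, X ∈ cone (insert n u) Y := by
  obtain ⟨hX, hu, hXY⟩ := hX
  obtain ⟨n, ⟨hnX, hn⟩, hi⟩ := hu.exists_insert (hX.sdiff u.finite_toSet).nonempty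
  have hnY : n ∈ Y := (hXY hnX).resolve_left fun hnu => lt_irrefl n (hn n hnu)
  refine ⟨n, ⟨hnY, hn⟩, hX, hi, hXY.trans ?_⟩
  gcongr
  exact Finset.subset_insert n u

lemma bars_of_insert {F : Set (Finset ℕ)} (h : ∀ n ∈ Y, Bars F (insert n u) Y) :
    Bars F u Y := by
  intro X hX
  obtain ⟨n, hn, hX⟩ := exists_mem_cone_insert hX
  obtain ⟨v, hvF, huv, hv⟩ := h n hn.1 X hX
  exact ⟨v, hvF, (Finset.subset_insert n u).trans huv, hv⟩

end Cone

/-! ### Bar induction -/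

lemma exists_infinite_of_forall_exists_insert {T : Set (Finset ℕ)} (h0 : ∅ ∈ T)
    (hT : ∀ u ∈ T, ∃ n ∈ above u, insert n u ∈ T) :
    ∃ X : Set ℕ, X.Infinite ∧ ∀ u, IsInit u X → u ∈ T := by
  choose! next hnext hnextT using hT
  let w : ℕ → Finset ℕ := fun k => (fun u => insert (next u) u)^[k] ∅
  have hw (k : ℕ) : w (k + 1) = insert (next (w k)) (w k) := Function.iterate_succ_apply' _ _ _
  have hwT (k : ℕ) : w k ∈ T := by
    induction k with
    | zero => exact h0
    | succ k ih => exact hw k ▸ hnextT _ ih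
  have hcard (k : ℕ) : (w k).card = k := by
    induction k with
    | zero => rfl
    | succ k ih =>
      rw [hw, Finset.card_insert_of_notMem fun h => lt_irrefl _ (hnext _ (hwT k) _ h), ih]
  have hinitial {j k : ℕ} (hjk : j ≤ k) : IsInit (w j) ↑(w k) := by
    induction k, hjk using Nat.le_induction with
    | base => exact ⟨subset_rfl, fun x hx _ _ _ => hx⟩
    | succ k _ ih => exact ih.trans (hw k ▸ isInit_insert (hnext _ (hwT k)))
  have hwX (k : ℕ) : IsInit (w k) (⋃ j, ↑(w j)) := by
    refine ⟨Set.subset_iUnion (fun j => (w j : Set ℕ)) k, fun x hx y hy hxy => ?_⟩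
    obtain ⟨j, hj⟩ := Set.mem_iUnion.1 hx
    rcases le_total j k with hjk | hkj
    · exact (hinitial hjk).1 hj
    · exact (hinitial hkj).2 x hj y hy hxy
  have hmem (k : ℕ) : next (w k) ∈ w (k + 1) := hw k ▸ Finset.mem_insert_self _ _
  have hlt : StrictMono fun k => next (w k) :=
    strictMono_nat_of_lt_succ fun k => hnext _ (hwT (k + 1)) _ (hmem k)
  refine ⟨⋃ j, ↑(w j), Set.infinite_of_injective_forall_mem hlt.injective fun k =>
    (hwX (k + 1)).1 (hmem k), fun u hu => ?_⟩
  have huw : u = w u.card := by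
    rcases hu.subset_total (hwX u.card) with h | h
    · exact Finset.eq_of_subset_of_card_le h (hcard _).le
    · exact (Finset.eq_of_subset_of_card_le h (hcard _).ge).symm
  exact huw ▸ hwT _

lemma bar_induction {A : Set ℕ} {F : Set (Finset ℕ)} (hbar : Bars F ∅ A)
    (hstep : ∀ u, (∀ n ∈ A ∩ above u, insert n u ∈ F) → u ∈ F) : ∅ ∈ F := by
  by_contra h0
  obtain ⟨X, hX, hXT⟩ := exists_infinite_of_forall_exists_insert
    (T := {u | ↑u ⊆ A ∧ u ∉ F}) ⟨by simp, h0⟩ fun u hu => by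
      obtain ⟨n, hn, hnF⟩ : ∃ n ∈ A ∩ above u, insert n u ∉ F := by
        by_contra! h
        exact hu.2 (hstep u h)
      refine ⟨n, hn.2, ?_, hnF⟩
      rw [Finset.coe_insert]
      exact Set.insert_subset hn.1 hu.1
  have hXA : X ⊆ A := fun x hx => by
    obtain ⟨w, hw, hxw⟩ := exists_isInit_mem hx
    exact (hXT w hw).1 hxw
  obtain ⟨u, huF, -, hu⟩ := hbar X (mem_cone_empty.2 ⟨hX, hXA⟩)
  exact (hXT u hu).2 huF

lemma exists_infinite_forall_inter_Ioi {X : Set ℕ} (hX : X.Infinite) {R : ℕ → Set ℕ → Prop}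
    (hR : ∀ n, Antitone (R n))
    (h : ∀ n ∈ X, ∀ Y ⊆ X, Y.Infinite → ∃ Y' ⊆ Y, Y'.Infinite ∧ R n Y') :
    ∃ Y ⊆ X, Y.Infinite ∧ ∀ n ∈ Y, R n (Y ∩ Set.Ioi n) := by
  have hnext (Y : Set ℕ) (hY : Y ⊆ X ∧ Y.Infinite) :
      ∃ Y', (Y' ⊆ X ∧ Y'.Infinite) ∧ Y' ⊆ Y ∩ Set.Ioi (sInf Y) ∧ R (sInf Y) Y' := by
    obtain ⟨Y', hY', hi, hRY'⟩ := h (sInf Y) (hY.1 (Nat.sInf_mem hY.2.nonempty))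
      (Y ∩ Set.Ioi (sInf Y)) (Set.inter_subset_left.trans hY.1)
      (by simpa [above, Set.Ioi] using infinite_inter_above hY.2 {sInf Y})
    exact ⟨Y', ⟨(hY'.trans Set.inter_subset_left).trans hY.1, hi⟩, hY', hRY'⟩
  choose! next hnextX hnext hnextR using hnext
  let W : ℕ → Set ℕ := fun k => next^[k] X
  have hW (k : ℕ) : W (k + 1) = next (W k) := Function.iterate_succ_apply' _ _ _
  have hWX (k : ℕ) : W k ⊆ X ∧ (W k).Infinite := by
    induction k with
    | zero => exact ⟨subset_rfl, hX⟩
    | succ k ih => exact hW k ▸ hnextX _ ih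
  have hWsucc (k : ℕ) : W (k + 1) ⊆ W k ∩ Set.Ioi (sInf (W k)) := hW k ▸ hnext _ (hWX k)
  have hWanti : Antitone W := antitone_nat_of_succ_le fun k =>
    (hWsucc k).trans Set.inter_subset_left
  have hmem (k : ℕ) : sInf (W k) ∈ W k := Nat.sInf_mem (hWX k).2.nonempty
  have hlt : StrictMono fun k => sInf (W k) :=
    strictMono_nat_of_lt_succ fun k => (hWsucc k (hmem (k + 1))).2
  refine ⟨Set.range fun k => sInf (W k), ?_, Set.infinite_range_of_injective hlt.injective, ?_⟩
  · rintro _ ⟨k, rfl⟩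
    exact (hWX k).1 (hmem k)
  · rintro _ ⟨k, rfl⟩
    refine hR _ ?_ (hnextR _ (hWX k))
    rintro _ ⟨⟨j, rfl⟩, hkj⟩
    exact hW k ▸ hWanti (Nat.succ_le_of_lt (hlt.lt_iff_lt.1 hkj)) (hmem j)

-- Bar induction applied to the statement that every infinite subset of `A` has an infinite subset
-- `Y` with `Q u Y`.
lemma exists_infinite_of_bars {A : Set ℕ} (hA : A.Infinite) {Q : Finset ℕ → Set ℕ → Prop}
    (hmono : ∀ u Y Y', Y' ∩ above u ⊆ Y → Q u Y → Q u Y') (hbar : Bars {u | Q u A} ∅ A)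
    (hstep : ∀ u Y, Y.Infinite → (∀ n ∈ Y, Q (insert n u) Y) → ∃ Y' ⊆ Y, Y'.Infinite ∧ Q u Y') :
    ∃ Y ⊆ A, Y.Infinite ∧ Q ∅ Y := by
  suffices h : ∅ ∈ {u | ∀ X ⊆ A, X.Infinite → ∃ Y ⊆ X, Y.Infinite ∧ Q u Y} from
    h A subset_rfl hA
  refine bar_induction (A := A) (fun X hX => ?_) fun u hu X hXA hX => ?_
  · obtain ⟨u, hQ, hu⟩ := hbar X hX
    exact ⟨u, fun X hXA hX => ⟨X, subset_rfl, hX,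
      hmono u A X (Set.inter_subset_left.trans hXA) hQ⟩, hu⟩
  · obtain ⟨Y, hYX, hY, hQ⟩ := exists_infinite_forall_inter_Ioi (infinite_inter_above hX u)
      (R := fun n Y => Q (insert n u) Y)
      (fun n Y' Y hY' => hmono _ Y Y' (Set.inter_subset_left.trans hY'))
      fun n hn Y hYX hY => hu n ⟨hXA hn.1, hn.2⟩ Y
        ((hYX.trans Set.inter_subset_left).trans hXA) hY
    obtain ⟨Y', hY'Y, hY', hQ'⟩ := hstep u Y hY fun n hn =>
      hmono _ (Y ∩ Set.Ioi n) Y (fun x hx => ⟨hx.1, hx.2 n (Finset.mem_insert_self n u)⟩)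
        (hQ n hn)
    exact ⟨Y', (hY'Y.trans hYX).trans Set.inter_subset_left, hY', hQ'⟩

/-! ### The lexicographic order on a barrier -/

instance : IsStrictOrder (Finset ℕ) LexLT where
  irrefl _ := lt_irrefl _
  trans _ _ _ := lt_trans

lemma sort_union_of_subset_above {s t : Finset ℕ} (h : ↑t ⊆ above s) :
    (s ∪ t).sort (· ≤ ·) = s.sort (· ≤ ·) ++ t.sort (· ≤ ·) := by
  have hlt {a b : ℕ} (ha : a ∈ s.sort (· ≤ ·)) (hb : b ∈ t.sort (· ≤ ·)) : a < b :=
    h ((t.mem_sort _).1 hb) a ((s.mem_sort _).1 ha)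
  have hnodup : (s.sort (· ≤ ·) ++ t.sort (· ≤ ·)).Nodup :=
    (s.sort_nodup _).append (t.sort_nodup _) fun _ ha hb => (hlt ha hb).false
  have hsorted : (s.sort (· ≤ ·) ++ t.sort (· ≤ ·)).Pairwise (· ≤ ·) :=
    List.pairwise_append.2
      ⟨s.pairwise_sort _, t.pairwise_sort _, fun _ ha _ hb => (hlt ha hb).le⟩
  rw [← (List.toFinset_sort (· ≤ ·) hnodup).2 hsorted, List.toFinset_append,
    Finset.sort_toFinset, Finset.sort_toFinset]

lemma IsInit.sort_eq_append {s t : Finset ℕ} (h : IsInit s ↑t) :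
    t.sort (· ≤ ·) = s.sort (· ≤ ·) ++ (t \ s).sort (· ≤ ·) := by
  rw [← sort_union_of_subset_above, Finset.union_sdiff_of_subset (Finset.coe_subset.1 h.1)]
  intro x hx
  rw [Finset.mem_coe, Finset.mem_sdiff] at hx
  exact h.mem_above hx.1 hx.2

lemma sort_insert_of_mem_above {u : Finset ℕ} {n : ℕ} (hn : n ∈ above u) :
    (insert n u).sort (· ≤ ·) = u.sort (· ≤ ·) ++ [n] := by
  rw [Finset.insert_eq, Finset.union_comm, sort_union_of_subset_above (by simpa using hn),
    Finset.sort_singleton]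

lemma lexLT_of_isInit_insert {u s t : Finset ℕ} {m n : ℕ} (hm : m ∈ above u) (hn : n ∈ above u)
    (hmn : m < n) (hs : IsInit (insert m u) ↑s) (ht : IsInit (insert n u) ↑t) : LexLT s t := by
  unfold LexLT
  rw [hs.sort_eq_append, ht.sort_eq_append, sort_insert_of_mem_above hm,
    sort_insert_of_mem_above hn, List.append_assoc, List.append_assoc]
  exact List.append_left_lt (List.cons_lt_cons_iff.2 (Or.inl hmn))

section Barrier

variable {B : Set (Finset ℕ)}

lemma IsBlock.bars (hB : IsBlock B) : Bars B ∅ (base B) := by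
  intro X hX
  rw [mem_cone_empty] at hX
  obtain ⟨s, hs, -, hsX⟩ := hB.exists_init X hX.2 hX.1
  exact ⟨s, hs, s.empty_subset, hsX⟩

lemma IsBlock.infinite_base (hB : IsBlock B) : (base B).Infinite := by
  intro hfin
  refine hB.infinite (Set.Finite.subset hfin.toFinset.powerset.finite_toSet fun s hs => ?_)
  rw [Finset.mem_coe, Finset.mem_powerset]
  exact fun x hx => hfin.mem_toFinset.2 ⟨s, hs, hx⟩

lemma IsBarrier.eq_of_isInit (hB : IsBarrier B) {s t : Finset ℕ} (hs : s ∈ B) (ht : t ∈ B)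
    {X : Set ℕ} (hsX : IsInit s X) (htX : IsInit t X) : s = t :=
  (hsX.subset_total htX).elim (hB.antichain.eq hs ht) (hB.antichain.eq' hs ht)

lemma wellFoundedOn_lexLT_of_insert {S : Set (Finset ℕ)} {u : Finset ℕ} (huS : u ∉ S)
    (hS : ∀ s ∈ S, IsInit u ↑s)
    (h : ∀ n ∈ base S ∩ above u, {s ∈ S | IsInit (insert n u) ↑s}.WellFoundedOn LexLT) :
    S.WellFoundedOn LexLT := by
  have hnext (s : Finset ℕ) (hs : s ∈ S) : ∃ n ∈ base S ∩ above u, IsInit (insert n u) ↑s := by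
    have hus : u ⊂ s := (Finset.coe_subset.1 (hS s hs).1).ssubset_of_ne fun hus => huS (hus ▸ hs)
    obtain ⟨n, ⟨hns, hnu⟩, hn⟩ := (hS s hs).exists_insert (by
      exact_mod_cast Finset.sdiff_nonempty.2 hus.2)
    exact ⟨n, ⟨⟨s, hs, hns⟩, hnu⟩, hn⟩
  choose! next hnextu hnext using hnext
  have hfst : S.WellFoundedOn ((· < ·) on next) := wellFounded_lt.onFun.wellFoundedOn
  have hsnd (n : ℕ) : (S ∩ next ⁻¹' {n}).WellFoundedOn (LexLT on id) := by
    rcases (S ∩ next ⁻¹' {n}).eq_empty_or_nonempty with hn | ⟨s, hs, rfl⟩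
    · exact hn ▸ Set.wellFoundedOn_empty _
    · exact (h _ (hnextu s hs)).subset fun t ht => ⟨ht.1, ht.2 ▸ hnext t ht.1⟩
  refine (hfst.prod_lex_of_wellFoundedOn_fiber hsnd).mono' fun s hs t ht hst => ?_
  rcases lt_trichotomy (next s) (next t) with hlt | heq | hgt
  · exact Prod.lex_def.2 (Or.inl hlt)
  · exact Prod.lex_def.2 (Or.inr ⟨heq, hst⟩)
  · exact absurd hst (lexLT_of_isInit_insert (hnextu t ht).2 (hnextu s hs).2 hgt
      (hnext t ht) (hnext s hs)).not_gt

lemma IsBarrier.wellFoundedOn_lexLT (hB : IsBarrier B) : B.WellFoundedOn LexLT := by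
  have hmem {u : Finset ℕ} (hu : u ∈ B) : {s ∈ B | IsInit u ↑s}.WellFoundedOn LexLT := by
    have hsub : {s ∈ B | IsInit u ↑s} ⊆ {u} := fun s hs =>
      (hB.antichain.eq hu hs.1 (Finset.coe_subset.1 hs.2.1)).symm
    exact Set.wellFoundedOn_singleton.subset hsub
  have hempty : ∅ ∈ {u | {s ∈ B | IsInit u ↑s}.WellFoundedOn LexLT} := by
    refine bar_induction (A := base B) (fun X hX => ?_) fun u hu => ?_
    · obtain ⟨u, hu, huX⟩ := hB.bars X hX
      exact ⟨u, hmem hu, huX⟩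
    by_cases huB : u ∈ B
    · exact hmem huB
    · refine wellFoundedOn_lexLT_of_insert (fun h => huB h.1) (fun s hs => hs.2) ?_
      rintro n ⟨⟨s, hs, hns⟩, hnu⟩
      exact (hu n ⟨⟨s, hs.1, hns⟩, hnu⟩).subset fun t ht => ⟨ht.1.1, ht.2⟩
  simpa [isInit_empty] using hempty

lemma IsBarrier.exists_lexTypeLE (hB : IsBarrier B) :
    ∃ α : Ordinal.{0}, α.card ≤ Cardinal.aleph0 ∧ LexTypeLE B α := by
  have hwo : IsWellOrder ↥B fun s t => LexLT s.1 t.1 :=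
    { wf := hB.wellFoundedOn_lexLT
      trichotomous := fun s t hst hts => by
        have hsort : s.1.sort (· ≤ ·) = t.1.sort (· ≤ ·) :=
          le_antisymm (not_lt.1 hts) (not_lt.1 hst)
        rw [Subtype.ext_iff, ← s.1.sort_toFinset (· ≤ ·), hsort, Finset.sort_toFinset] }
  exact ⟨_, (Ordinal.card_type _).trans_le Cardinal.mk_le_aleph0, hwo, le_rfl⟩

lemma IsBQO.isGood {Q : Type*} [LE Q] (hQ : IsBQO Q) (hB : IsBarrier B) (f : ↥B → Q) :
    IsGood f := by
  obtain ⟨α, hα, hBα⟩ := hB.exists_lexTypeLE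
  exact hQ α hα B hB hBα f

end Barrier

/-! ### Deleting the least element -/

/-- The set `X` with its least element deleted: the analogue of `tail` for infinite sets. -/
def tailSet (X : Set ℕ) : Set ℕ := {n ∈ X | ∃ m ∈ X, m < n}

lemma coe_tail (s : Finset ℕ) : (↑(tail s) : Set ℕ) = tailSet ↑s := by
  ext n
  simp [tail, tailSet]

lemma tailSet_subset (X : Set ℕ) : tailSet X ⊆ X := fun _ h => h.1

lemma eq_insert_sInf_tailSet {X : Set ℕ} (hX : X.Nonempty) : X = insert (sInf X) (tailSet X) := by
  refine Set.Subset.antisymm (fun x hx => ?_)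
    (Set.insert_subset (Nat.sInf_mem hX) (tailSet_subset X))
  rcases (Nat.sInf_le hx).eq_or_lt with h | h
  · exact Or.inl h.symm
  · exact Or.inr ⟨hx, sInf X, Nat.sInf_mem hX, h⟩

lemma sInf_lt_of_mem_tailSet {X : Set ℕ} {x : ℕ} (hx : x ∈ tailSet X) : sInf X < x :=
  let ⟨_, _, hm, hmx⟩ := hx
  (Nat.sInf_le hm).trans_lt hmx

lemma infinite_tailSet {X : Set ℕ} (hX : X.Infinite) : (tailSet X).Infinite := fun hfin =>
  hX (eq_insert_sInf_tailSet hX.nonempty ▸ hfin.insert _)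

lemma isInit_tail {u : Finset ℕ} {X : Set ℕ} (hu : IsInit u X) : IsInit (tail u) (tailSet X) := by
  rw [IsInit, coe_tail]
  refine ⟨fun x ⟨hx, m, hm, hmx⟩ => ⟨hu.1 hx, m, hu.1 hm, hmx⟩, fun x hx y hy hxy => ?_⟩
  obtain ⟨hxX, m, hm, hmx⟩ := hx
  have hyu : y ∈ u := Finset.mem_of_mem_filter y hy
  exact Finset.mem_filter.2
    ⟨hu.2 x hxX y hyu hxy, m, hu.2 m hm y hyu (hmx.le.trans hxy), hmx⟩

lemma tailSet_mem_cone {u : Finset ℕ} {X Y : Set ℕ} (hX : X ∈ cone u Y) :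
    tailSet X ∈ cone (tail u) Y := by
  obtain ⟨hX, hu, hXY⟩ := hX
  refine ⟨infinite_tailSet hX, isInit_tail hu, fun x ⟨hx, m, hm, hmx⟩ => ?_⟩
  rcases hXY hx with hxu | hxY
  · exact Or.inl (Finset.mem_filter.2 ⟨hxu, m, hu.2 m hm x hxu hmx.le, hmx⟩)
  · exact Or.inr hxY

lemma tailSet_union {r : Finset ℕ} {Z : Set ℕ} (hr : r.Nonempty) (hZ : Z ⊆ above r) :
    tailSet (↑r ∪ Z) = ↑(tail r) ∪ Z := by
  obtain ⟨a, ha⟩ := hr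
  rw [coe_tail]
  ext x
  constructor
  · rintro ⟨hx | hx, m, hm | hm, hmx⟩
    · exact Or.inl ⟨hx, m, hm, hmx⟩
    · exact absurd hmx (hZ hm x hx).not_gt
    · exact Or.inr hx
    · exact Or.inr hx
  · rintro (⟨hx, m, hm, hmx⟩ | hx)
    · exact ⟨Or.inl hx, m, Or.inl hm, hmx⟩
    · exact ⟨Or.inr hx, a, Or.inl ha, hZ hx a ha⟩

lemma tail_singleton (a : ℕ) : tail {a} = ∅ := by
  simp [tail, Finset.filter_singleton]

lemma tail_insert {r : Finset ℕ} {m : ℕ} (hr : r.Nonempty) (hm : m ∈ above r) :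
    tail (insert m r) = insert m (tail r) := by
  have h := tailSet_union hr (Set.singleton_subset_iff.2 hm)
  rw [← Finset.coe_inj, coe_tail, Finset.coe_insert, Finset.coe_insert, Set.insert_eq,
    Set.union_comm, h, Set.union_comm, Set.insert_eq]

lemma tail_ssubset {r : Finset ℕ} (hr : r.Nonempty) : tail r ⊂ r := by
  refine (Finset.filter_subset _ r).ssubset_of_mem_notMem (r.min'_mem hr) fun h => ?_
  obtain ⟨-, m, hm, hlt⟩ := Finset.mem_filter.1 h
  exact (r.min'_le m hm).not_gt hlt

lemma IsInit.subset_union_tail {s r : Finset ℕ} (hs : IsInit s ↑r) (hne : s.Nonempty) :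
    r ⊆ s ∪ tail r := by
  intro x hx
  obtain ⟨y, hy⟩ := hne
  rw [Finset.mem_union]
  rcases le_or_gt x y with hxy | hyx
  · exact Or.inl (hs.2 x hx y hy hxy)
  · exact Or.inr (Finset.mem_filter.2 ⟨hx, y, hs.1 hy, hyx⟩)

lemma IsInit.exists_tail_eq {t : Finset ℕ} {X : Set ℕ} (hX : X.Nonempty)
    (ht : IsInit t (tailSet X)) : ∃ r : Finset ℕ, r.Nonempty ∧ IsInit r X ∧ tail r = t := by
  have hlt : ↑t ⊆ above {sInf X} := fun x hx y hy =>
    Finset.mem_singleton.1 hy ▸ sInf_lt_of_mem_tailSet (ht.1 hx)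
  refine ⟨insert (sInf X) t, Finset.insert_nonempty _ _, ⟨?_, fun x hx y hy hxy => ?_⟩, ?_⟩
  · rw [Finset.coe_insert]
    exact Set.insert_subset (Nat.sInf_mem hX) (ht.1.trans (tailSet_subset X))
  · rw [eq_insert_sInf_tailSet hX] at hx
    rcases hx with rfl | hx
    · exact Finset.mem_insert_self _ _
    · have hyt : y ∈ t := (Finset.mem_insert.1 hy).resolve_left fun hy =>
        ((sInf_lt_of_mem_tailSet hx).trans_le hxy).ne' hy
      exact Finset.mem_insert_of_mem (ht.2 x hx y hyt hxy)
  · have htail := tailSet_union (Finset.singleton_nonempty (sInf X)) hlt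
    rw [tail_singleton, Finset.coe_empty, Set.empty_union] at htail
    rw [← Finset.coe_inj, coe_tail, Finset.insert_eq, Finset.coe_union, htail]

lemma IsBarrier.shift {B : Set (Finset ℕ)} (hB : IsBarrier B) {s t : Finset ℕ} (hs : s ∈ B)
    (ht : t ∈ B) {X : Set ℕ} (hX : X.Nonempty) (hsX : IsInit s X) (htX : IsInit t (tailSet X)) :
    Shift s t := by
  obtain ⟨r, hr, hrX, rfl⟩ := htX.exists_tail_eq hX
  have hrs : ¬ r ⊆ s := fun hrs =>
    let htr := (tail_ssubset hr).trans_subset hrs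
    htr.ne (hB.antichain.eq ht hs htr.subset)
  have hsr : s ⊆ r := (hsX.subset_total hrX).resolve_right hrs
  exact ⟨r, hsX.isInit_of_subset hrX hsr, fun h => hrs h.ge, rfl⟩

/-! ### Fusion for maps into a well-quasi-order -/

section Const

variable {α : Type*} {φ : Set ℕ → α} {u : Finset ℕ} {Y Y' : Set ℕ}

/-- The `u` for which `φ` is constant on the neighbourhood `[u, Y]`. -/
def constNodes (φ : Set ℕ → α) (Y : Set ℕ) : Set (Finset ℕ) :=
  {u | ∃ c, ∀ X ∈ cone u Y, φ X = c}

lemma mem_constNodes_mono (h : Y' ∩ above u ⊆ Y) (hu : u ∈ constNodes φ Y) :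
    u ∈ constNodes φ Y' :=
  hu.imp fun _ hc X hX => hc X (cone_mono h hX)

lemma mem_constNodes_of_insert {c : α} (h : ∀ n ∈ Y, ∀ X ∈ cone (insert n u) Y, φ X = c) :
    u ∈ constNodes φ Y :=
  ⟨c, fun X hX =>
    let ⟨n, hn, hX⟩ := exists_mem_cone_insert hX
    h n hn.1 X hX⟩

end Const

/-- The values of `φ` on `[v, Y]` tend to the ideal `I` as the first element after `v` tends to
infinity. -/
structure HasLimit {P : Type*} [LE P] (φ : Set ℕ → P) (v : Finset ℕ) (Y : Set ℕ)
    (I : Order.Ideal P) : Prop where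
  bounded : ∀ n ∈ Y ∩ above v, ∃ q ∈ I, ∀ X ∈ cone (insert n v) Y, φ X ≤ q
  eventually_le : ∀ q ∈ I, ∀ᶠ n in atTop, n ∈ Y → ∀ X ∈ cone (insert n v) Y, q ≤ φ X

lemma HasLimit.mono {P : Type*} [LE P] {φ : Set ℕ → P} {v : Finset ℕ} {Y Y' : Set ℕ}
    {I : Order.Ideal P} (hI : HasLimit φ v Y I) (h : Y' ∩ above v ⊆ Y) : HasLimit φ v Y' I := by
  have hcone (n : ℕ) : cone (insert n v) Y' ⊆ cone (insert n v) Y :=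
    cone_mono ((Set.inter_subset_inter_right _ (above_anti (Finset.subset_insert n v))).trans h)
  refine ⟨fun n hn => ?_, fun q hq => ?_⟩
  · obtain ⟨q, hq, hle⟩ := hI.bounded n ⟨h hn, hn.2⟩
    exact ⟨q, hq, fun X hX => hle X (hcone n hX)⟩
  · filter_upwards [hI.eventually_le q hq, eventually_mem_above v] with n hle hnv hn X hX
    exact hle (h ⟨hn, hnv⟩) X (hcone n hX)

/-- The ideal generated by a monotone sequence. -/
def idealOfMonotone {P : Type*} [Preorder P] (a : ℕ → P) (ha : Monotone a) : Order.Ideal P where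
  carrier := {q | ∃ i, q ≤ a i}
  lower' _ _ h := fun ⟨i, hi⟩ => ⟨i, h.trans hi⟩
  nonempty' := ⟨a 0, 0, le_rfl⟩
  directed' := fun _ ⟨i, hi⟩ _ ⟨j, hj⟩ =>
    ⟨a (max i j), ⟨_, le_rfl⟩, hi.trans (ha (le_max_left i j)), hj.trans (ha (le_max_right i j))⟩

section Fusion

variable {P : Type*} [PartialOrder P] {φ : Set ℕ → P} {u : Finset ℕ} {Y Y' : Set ℕ}

/-- The `v` at which `φ` tends to a non-principal ideal. -/
def limitNodes (φ : Set ℕ → P) (Y : Set ℕ) : Set (Finset ℕ) :=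
  {v | ∃ I : NonPrincipalIdeal P, HasLimit φ v Y I.1}

lemma Bars.limitNodes_mono (hbar : Bars (limitNodes φ Y) u Y) (h : Y' ∩ above u ⊆ Y) :
    Bars (limitNodes φ Y') u Y' := by
  intro X hX
  obtain ⟨v, ⟨I, hI⟩, huv, hv⟩ := hbar X (cone_mono h hX)
  have hv' : Y' ∩ above v ⊆ Y := (Set.inter_subset_inter_right _ (above_anti huv)).trans h
  exact ⟨v, ⟨I, hI.mono hv'⟩, huv, hv⟩

lemma exists_monotone_comp_strictMono [WellQuasiOrderedLE P] (p : ℕ → P) (hY : Y.Infinite) :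
    ∃ e : ℕ → ℕ, StrictMono e ∧ (∀ k, e k ∈ Y) ∧ Monotone (p ∘ e) := by
  obtain ⟨g, hg⟩ := wellQuasiOrdered_le.exists_monotone_subseq fun k => p (Nat.nth (· ∈ Y) k)
  exact ⟨fun k => Nat.nth (· ∈ Y) (g k), (Nat.nth_strictMono hY).comp g.strictMono,
    fun k => Nat.nth_mem_of_infinite hY (g k), fun i j hij => hg i j hij⟩

lemma exists_const_or_tendsto_ideal [WellQuasiOrderedLE P] (p : ℕ → P) (hY : Y.Infinite) :
    ∃ Y' ⊆ Y, Y'.Infinite ∧ ((∃ c, ∀ n ∈ Y', p n = c) ∨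
      ∃ I : NonPrincipalIdeal P, (∀ n ∈ Y', p n ∈ I.1) ∧
        ∀ q ∈ I.1, ∀ᶠ n in atTop, n ∈ Y' → q ≤ p n) := by
  obtain ⟨e, he, heY, hpe⟩ := exists_monotone_comp_strictMono p hY
  have hmem (k : ℕ) : p (e k) ∈ idealOfMonotone (p ∘ e) hpe := ⟨k, le_rfl⟩
  by_cases hI : ∃ x, idealOfMonotone (p ∘ e) hpe = Order.Ideal.principal x
  · obtain ⟨x, hx⟩ := hI
    obtain ⟨k, hk⟩ : x ∈ idealOfMonotone (p ∘ e) hpe := hx ▸ Order.Ideal.mem_principal_self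
    refine ⟨e '' Set.Ici k, Set.image_subset_iff.2 fun j _ => heY j,
      (Set.Ici_infinite k).image he.injective.injOn, Or.inl ⟨x, ?_⟩⟩
    rintro _ ⟨j, hj, rfl⟩
    exact le_antisymm (Order.Ideal.mem_principal.1 (hx ▸ hmem j)) (hk.trans (hpe hj))
  · refine ⟨Set.range e, Set.range_subset_iff.2 heY, Set.infinite_range_of_injective he.injective,
      Or.inr ⟨⟨idealOfMonotone (p ∘ e) hpe, not_exists.1 hI⟩, Set.forall_mem_range.2 hmem, ?_⟩⟩
    rintro q ⟨i, hi⟩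
    filter_upwards [eventually_ge_atTop (e i)]
    rintro _ hn ⟨j, rfl⟩
    exact hi.trans (hpe (he.le_iff_le.1 hn))

lemma exists_mem_constNodes_or_mem_limitNodes [WellQuasiOrderedLE P] (hY : Y.Infinite)
    (h : ∀ n ∈ Y, insert n u ∈ constNodes φ Y) :
    ∃ Y' ⊆ Y, Y'.Infinite ∧ (u ∈ constNodes φ Y' ∨ u ∈ limitNodes φ Y') := by
  have hval (n : ℕ) : ∃ c, n ∈ Y → ∀ X ∈ cone (insert n u) Y, φ X = c := by
    by_cases hn : n ∈ Y
    · exact (h n hn).imp fun c hc _ => hc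
    · exact ⟨φ ∅, fun hn' => absurd hn' hn⟩
  choose p hp using hval
  obtain ⟨Y', hY'Y, hY', hpY'⟩ := exists_const_or_tendsto_ideal p hY
  have hp' (n : ℕ) (hn : n ∈ Y') (X : Set ℕ) (hX : X ∈ cone (insert n u) Y') : φ X = p n :=
    hp n (hY'Y hn) X (cone_mono (Set.inter_subset_left.trans hY'Y) hX)
  refine ⟨Y', hY'Y, hY', hpY'.imp ?_ ?_⟩
  · rintro ⟨c, hc⟩
    exact mem_constNodes_of_insert fun n hn X hX => (hp' n hn X hX).trans (hc n hn)
  · rintro ⟨I, hmem, hle⟩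
    refine ⟨I, fun n hn => ⟨p n, hmem n hn.1, fun X hX => (hp' n hn.1 X hX).le⟩, fun q hq => ?_⟩
    filter_upwards [hle q hq] with n hqn hn X hX
    exact (hqn hn).trans_eq (hp' n hn X hX).symm

lemma exists_const_or_bars_limitNodes [WellQuasiOrderedLE P] {A : Set ℕ} (hA : A.Infinite)
    (hφ : Bars (constNodes φ A) ∅ A) :
    ∃ Y ⊆ A, Y.Infinite ∧ (∅ ∈ constNodes φ Y ∨ Bars (limitNodes φ Y) ∅ Y) := by
  refine exists_infinite_of_bars hA
    (Q := fun u Y => u ∈ constNodes φ Y ∨ Bars (limitNodes φ Y) u Y)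
    (fun u Y Y' h => Or.imp (mem_constNodes_mono h) (Bars.limitNodes_mono · h))
    (fun X hX => ?_) fun u Y hY h => ?_
  · obtain ⟨u, hu, huX⟩ := hφ X hX
    exact ⟨u, Or.inl hu, huX⟩
  let S : Set ℕ := {n | insert n u ∈ constNodes φ Y}
  rw [← Set.inter_union_compl Y S, Set.infinite_union] at hY
  rcases hY with hS | hS
  · obtain ⟨Y', hY'Y, hY', hu⟩ := exists_mem_constNodes_or_mem_limitNodes hS
      fun n hn => mem_constNodes_mono (Set.inter_subset_left.trans Set.inter_subset_left) hn.2
    exact ⟨Y', hY'Y.trans Set.inter_subset_left, hY',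
      hu.imp_right fun hu X hX => ⟨u, hu, subset_rfl, hX.2.1⟩⟩
  · exact ⟨Y ∩ Sᶜ, Set.inter_subset_left, hS, Or.inr <| bars_of_insert fun n hn =>
      ((h n hn.1).resolve_left hn.2).limitNodes_mono
        (Set.inter_subset_left.trans Set.inter_subset_left)⟩

end Fusion

/-! ### Bars contain barriers -/

instance isEmpty_nonPrincipalIdeal_of_finite {P : Type*} [PartialOrder P] [Finite P] :
    IsEmpty (NonPrincipalIdeal P) := by
  refine ⟨fun ⟨I, hI⟩ => ?_⟩
  obtain ⟨x, hx⟩ := (Set.toFinite (I : Set P)).exists_maximal I.nonempty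
  refine hI x (le_antisymm (fun y hy => ?_) (Order.Ideal.principal_le_iff.2 hx.prop))
  exact I.directed.is_top_of_is_max hx.prop (fun a ha h => hx.le_of_ge ha h) y hy

-- A finite set ordered by equality is well-quasi-ordered and has no non-principal ideals.
lemma exists_const_of_finite {α : Type*} [Finite α] {φ : Set ℕ → α} {A : Set ℕ} (hA : A.Infinite)
    (hφ : Bars (constNodes φ A) ∅ A) : ∃ Z ⊆ A, Z.Infinite ∧ ∅ ∈ constNodes φ Z := by
  let _ : PartialOrder α :=
    { le := Eq
      le_refl := Eq.refl
      le_trans := fun _ _ _ => Eq.trans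
      le_antisymm := fun _ _ h _ => h }
  have : WellQuasiOrderedLE α := Finite.to_wellQuasiOrderedLE
  obtain ⟨Z, hZA, hZ, hc | hlim⟩ := exists_const_or_bars_limitNodes hA hφ
  · exact ⟨Z, hZA, hZ, hc⟩
  · obtain ⟨-, ⟨I, -⟩, -⟩ := hlim Z (mem_cone_empty.2 ⟨hZ, subset_rfl⟩)
    exact isEmptyElim I

lemma isBarrier_of_bars {B : Set (Finset ℕ)} {Z : Set ℕ} (hZ : Z.Infinite) (hBZ : base B ⊆ Z)
    (hbar : Bars B ∅ Z) (h0 : ∅ ∉ B) (hanti : IsAntichain (· ⊆ ·) B) : IsBarrier B := by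
  have hinitial (X : Set ℕ) (hXZ : X ⊆ Z) (hX : X.Infinite) : ∃ s ∈ B, s ≠ ∅ ∧ IsInit s X := by
    obtain ⟨s, hs, -, hsX⟩ := hbar X (mem_cone_empty.2 ⟨hX, hXZ⟩)
    exact ⟨s, hs, fun h => h0 (h ▸ hs), hsX⟩
  refine ⟨⟨fun hfin => ?_, fun X hX => hinitial X (hX.trans hBZ)⟩, hanti⟩
  have hbase : (base B).Finite :=
    (hfin.biUnion fun s _ => s.finite_toSet).subset fun n ⟨s, hs, hn⟩ => Set.mem_biUnion hs hn
  obtain ⟨s, hs, hne, hsX⟩ := hinitial (Z \ base B) Set.sdiff_subset (hZ.sdiff hbase)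
  obtain ⟨x, hx⟩ := Finset.nonempty_iff_ne_empty.2 hne
  exact (hsX.1 hx).2 ⟨s, hs, hx⟩

lemma exists_isBarrier_subset {F : Set (Finset ℕ)} {Y : Set ℕ} (hY : Y.Infinite)
    (hF : Bars F ∅ Y) (h0 : ∅ ∉ F) : ∃ B ⊆ F, IsBarrier B ∧ base B ⊆ Y := by
  let C (X : Set ℕ) : Prop := ∃ s, Minimal (· ∈ F) s ∧ IsInit s X
  have hC : Bars (constNodes C Y) ∅ Y := by
    intro X hX
    obtain ⟨s, hs, h⟩ := hF X hX
    refine ⟨s, ⟨C ↑s, fun X' hX' => propext ⟨?_, ?_⟩⟩, h⟩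
    · rintro ⟨t, ht, htX⟩
      have hts : t ⊆ s := (htX.subset_total hX'.2.1).elim id (ht.le_of_le hs)
      exact ⟨t, ht, htX.isInit_of_subset hX'.2.1 hts⟩
    · rintro ⟨t, ht, hts⟩
      exact ⟨t, ht, hts.trans hX'.2.1⟩
  obtain ⟨Z, hZY, hZ, c, hc⟩ := exists_const_of_finite hY hC
  obtain ⟨X₀, hX₀, hCX₀⟩ : ∃ X₀ ∈ cone ∅ Z, C X₀ := by
    obtain ⟨s, hs, -, hsZ⟩ := hF Z (mem_cone_empty.2 ⟨hZ, hZY⟩)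
    obtain ⟨t, hts, ht⟩ := exists_minimal_le_of_wellFoundedLT (· ∈ F) s hs
    have htZ : ↑t ⊆ Z := (Finset.coe_subset.2 hts).trans hsZ.1
    have hX := union_above_mem_cone hZ t
    exact ⟨_, cone_subset_cone (isInit_empty _) (htZ.trans Set.subset_union_right) hX,
      t, ht, hX.2.1⟩
  have hCZ (X : Set ℕ) (hX : X ∈ cone ∅ Z) : C X := by rwa [hc X hX, ← hc X₀ hX₀]
  have hbase : base {s | Minimal (· ∈ F) s ∧ ↑s ⊆ Z} ⊆ Z := fun n ⟨s, hs, hn⟩ => hs.2 hn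
  refine ⟨{s | Minimal (· ∈ F) s ∧ ↑s ⊆ Z}, fun s hs => hs.1.prop, ?_, hbase.trans hZY⟩
  refine isBarrier_of_bars hZ hbase (fun X hX => ?_) (fun h => h0 h.1.prop)
    ((setOfPred_minimal_antichain _).subset fun s hs => hs.1)
  obtain ⟨s, hs, hsX⟩ := hCZ X hX
  exact ⟨s, ⟨hs, hsX.1.trans (mem_cone_empty.1 hX).2⟩, s.empty_subset, hsX⟩

/-! ### Bad maps -/

/-- `φ` is bad on the infinite subsets of `Y`: the infinitary counterpart of a map on a barrier
that is not good. -/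
def IsBadOn {P : Type*} [LE P] (φ : Set ℕ → P) (Y : Set ℕ) : Prop :=
  ∀ X ∈ cone ∅ Y, ¬ φ X ≤ φ (tailSet X)

lemma IsBarrier.exists_isBadOn {P : Type*} [LE P] {B : Set (Finset ℕ)} (hB : IsBarrier B)
    {f : ↥B → P} (hf : ¬ IsGood f) :
    ∃ φ : Set ℕ → P, Bars (constNodes φ (base B)) ∅ (base B) ∧ IsBadOn φ (base B) := by
  have hext (X : Set ℕ) : ∃ p, ∀ s : ↥B, IsInit s X → p = f s := by
    by_cases hX : ∃ s : ↥B, IsInit s X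
    · obtain ⟨s, hs⟩ := hX
      exact ⟨f s, fun t ht => congrArg f (Subtype.ext (hB.eq_of_isInit s.2 t.2 hs ht))⟩
    · obtain ⟨s, hs⟩ := hB.infinite.nonempty
      exact ⟨f ⟨s, hs⟩, fun t ht => absurd ⟨t, ht⟩ hX⟩
  choose φ hφ using hext
  refine ⟨φ, fun X hX => ?_, fun X hX hle => hf ?_⟩
  · obtain ⟨s, hs, h⟩ := hB.bars X hX
    exact ⟨s, ⟨f ⟨s, hs⟩, fun X' hX' => hφ X' ⟨s, hs⟩ hX'.2.1⟩, h⟩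
  · obtain ⟨s, hs, -, hsX⟩ := hB.bars X hX
    obtain ⟨t, ht, -, htX⟩ := hB.bars (tailSet X) (tailSet_mem_cone hX)
    refine ⟨⟨s, hs⟩, ⟨t, ht⟩, hB.shift hs ht hX.1.nonempty hsX htX, ?_⟩
    rwa [hφ X ⟨s, hs⟩ hsX, hφ (tailSet X) ⟨t, ht⟩ htX] at hle

lemma IsBadOn.mono {P : Type*} [LE P] {φ : Set ℕ → P} {Y Y' : Set ℕ} (h : IsBadOn φ Y)
    (hY : Y' ⊆ Y) : IsBadOn φ Y' :=
  fun X hX => h X (cone_mono (Set.inter_subset_left.trans hY) hX)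

lemma IsBadOn.empty_notMem_constNodes {P : Type*} [Preorder P] {φ : Set ℕ → P} {Y : Set ℕ}
    (h : IsBadOn φ Y) (hY : Y.Infinite) : ∅ ∉ constNodes φ Y := by
  rintro ⟨c, hc⟩
  have hYY : Y ∈ cone ∅ Y := mem_cone_empty.2 ⟨hY, subset_rfl⟩
  exact h Y hYY ((hc Y hYY).trans (hc _ (tailSet_mem_cone hYY)).symm).le

lemma HasLimit.exists_le_tailSet {P : Type*} [Preorder P] {φ : Set ℕ → P} {v r : Finset ℕ}
    {Y : Set ℕ} {I I' : Order.Ideal P} (hI : HasLimit φ v Y I) (hI' : HasLimit φ (tail r) Y I')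
    (hII' : I ≤ I') (hY : Y.Infinite) (hrY : ↑r ⊆ Y) (hv : IsInit v ↑r) (hvr : v ≠ r) :
    ∃ X ∈ cone ∅ Y, φ X ≤ φ (tailSet X) := by
  have hvr' : v ⊂ r := (Finset.coe_subset.1 hv.1).ssubset_of_ne hvr
  obtain ⟨n, ⟨hnr, hnv⟩, hn⟩ := hv.exists_insert (by
    exact_mod_cast Finset.sdiff_nonempty.2 hvr'.2)
  obtain ⟨q, hq, hXq⟩ := hI.bounded n ⟨hrY hnr, hnv⟩
  obtain ⟨m, hmY, hqm, hmr⟩ := ((Nat.frequently_atTop_iff_infinite.2 hY).and_eventually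
    ((hI'.eventually_le q (hII' hq)).and (eventually_mem_above r))).exists
  have hX := union_above_mem_cone hY (insert m r)
  have hmrY : ↑(insert m r) ⊆ Y := by
    rw [Finset.coe_insert]
    exact Set.insert_subset hmY hrY
  have hsub (w : Finset ℕ) : ↑(insert m r) ⊆ ↑w ∪ Y := hmrY.trans Set.subset_union_right
  refine ⟨_, cone_subset_cone (isInit_empty _) (hsub ∅) hX, ?_⟩
  have hXn := cone_subset_cone (hn.trans (isInit_insert hmr)) (hsub _) hX
  have htail := tailSet_mem_cone hX
  rw [tail_insert ⟨n, hnr⟩ hmr] at htail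
  exact (hXq _ hXn).trans (hqm hmY _ htail)

lemma IsBadOn.empty_notMem_limitNodes {P : Type*} [PartialOrder P] {φ : Set ℕ → P} {Y : Set ℕ}
    (h : IsBadOn φ Y) (hY : Y.Infinite) : ∅ ∉ limitNodes φ Y := by
  rintro ⟨I, hI⟩
  obtain ⟨a, ha⟩ := hY.nonempty
  obtain ⟨X, hX, hle⟩ := hI.exists_le_tailSet (r := {a}) ((tail_singleton a).symm ▸ hI) le_rfl hY
    (by simpa using ha) (isInit_empty _) (Finset.singleton_ne_empty a).symm
  exact h X hX hle

lemma IsBQO.not_isBadOn_of_bars {P : Type*} [PartialOrder P] {φ : Set ℕ → P} {Y : Set ℕ}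
    (hbqo : IsBQO (NonPrincipalIdeal P)) (hY : Y.Infinite) (hlim : Bars (limitNodes φ Y) ∅ Y) :
    ¬ IsBadOn φ Y := by
  intro hbad
  have h0 := hbad.empty_notMem_limitNodes hY
  obtain ⟨B, hBlim, hB, hBY⟩ := exists_isBarrier_subset hY hlim h0
  choose I hI using fun s : ↥B => hBlim s.2
  obtain ⟨s, t, ⟨r, hsr, hne, htr⟩, hle⟩ := hbqo.isGood hB I
  have hs : s.1.Nonempty := Finset.nonempty_iff_ne_empty.2 fun h => h0 (h ▸ hBlim s.2)
  have hrY : ↑r ⊆ Y := fun x hx =>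
    hBY <| (Finset.mem_union.1 (hsr.subset_union_tail hs hx)).elim (⟨s, s.2, ·⟩)
      fun hx => ⟨t, t.2, htr ▸ hx⟩
  obtain ⟨X, hX, hle⟩ := (hI s).exists_le_tailSet (htr ▸ hI t) hle hY hrY hsr hne
  exact hbad X hX hle

end BQO

theorem corollary1p2 {P : Type*} [PartialOrder P]
    (hwqo : WellQuasiOrderedLE P) (hbqo : BQO.IsBQO (BQO.NonPrincipalIdeal P)) :
    BQO.IsBQO P := by
  intro α _ B hB _ f
  by_contra hf
  obtain ⟨φ, hφ, hbad⟩ := hB.exists_isBadOn hf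
  obtain ⟨Y, hYB, hY, hconst | hlim⟩ :=
    BQO.exists_const_or_bars_limitNodes hB.infinite_base hφ
  · exact (hbad.mono hYB).empty_notMem_constNodes hY hconst
  · exact hbqo.not_isBadOn_of_bars hY hlim (hbad.mono hYB)
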